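/- For a finite group $G$ let $\operatorname{cdeg}(G)=|C(G)|/|L(G)|$ be its cyclicity degree, where $C(G)$ is the set of cyclic subgroups of $G$ and $L(G)$ the set of all subgroups of $G$. For $n\ge 1$ put $f(n)=\operatorname{cdeg}(\mathbb{Z}_n\times\mathbb{Z}_n)$, where $\mathbb{Z}_n=\mathbb{Z}/n\mathbb{Z}$. Then $f$ is multiplicative: $f(1)=1$ and $f(mn)=f(m)f(n)$ for all $m,n\ge 1$ with $\gcd(m,n)=1$. For each prime $p$ the series $\sum_{a=0}^{\infty} f(p^a)/p^a$ converges, the product $$M=\prod_p\left(1-\frac1p\right)\sum_{a=0}^{\infty}\frac{f(p^a)}{p^a}$$ over all primes $p$ converges (unconditionally), its value satisfies $0.742<M<0.743$, and, as the real variable $x$ tends to $\infty$, $$\sum_{n\le x}\operatorname{cdeg}(\mathbb{Z}_n\times\mathbb{Z}_n)=Mx+O(\log^3 x).$$ -/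

import Mathlib

open Filter Asymptotics

/-- The cyclicity degree of a (finite) group: the proportion of cyclic subgroups
among all subgroups. -/
noncomputable def cdeg (G : Type*) [Group G] : ℝ :=
  (Nat.card {H : Subgroup G // IsCyclic H} : ℝ) / (Nat.card (Subgroup G) : ℝ)

/-- The cyclicity degree of `ℤ/nℤ × ℤ/nℤ`, for `n ≥ 1`. -/
noncomputable def cdegSq (n : ℕ) : ℝ :=
  cdeg (Multiplicative (ZMod n × ZMod n))

/-! Coprime orders split subgroups, and cyclic subgroups, as products, so everything reduces to
`(ℤ/pᵃ)²`. There a subgroup is non-cyclic exactly when it contains the whole p-torsion, and the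
quotient by the p-torsion is `(ℤ/pᵃ⁻¹)²`. With `U a` the number of subgroups, this gives `f(pᵃ) = 1
- r a`, where `r a = U (a-1) / U a` and `r 0 = 0`; counting generators yields `U (a+1) = p * U a +
2a + 3`.

The Möbius transform `g = f * μ` takes the value `r a - r (a+1)` at `pᵃ⁺¹`, and the recursion bounds
it by `(2a+1)/pᵃ⁺¹`. Hence `|g n| * n ≤ d₃ n`, with `d₃ = ζ * ζ * ζ`. So `∑ g n / n` converges
absolutely, its Euler product is `M`, and the error in `∑ g d ⌊x/d⌋` is at most `e * ζ(1 + 1/log x)³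
= O(log³ x)` by Rankin's trick (`abs_sum_mul_zeta_sub_le`).

For the numerical bounds, each local factor is divided by `1 - p⁻²`, whose product is `6/π²`. The
ratios are at least 1 and at most `1 + O(p⁻³)`, so a short product of rational bounds and a
telescoping tail suffice (`mean_bounds`). -/

/-! ### Multiplicativity over coprime orders -/

/-- The number of cyclic subgroups. -/
noncomputable def cyclicCount (G : Type*) [Group G] : ℕ := Nat.card {H : Subgroup G // IsCyclic H}

theorem cdeg_eq (G : Type*) [Group G] :
    cdeg G = (cyclicCount G : ℝ) / (Nat.card (Subgroup G) : ℝ) := rfl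

theorem card_subgroup_congr {G K : Type*} [Group G] [Group K] (e : G ≃* K) :
    Nat.card (Subgroup G) = Nat.card (Subgroup K) :=
  Nat.card_congr e.mapSubgroup.toEquiv

theorem cyclicCount_congr {G K : Type*} [Group G] [Group K] (e : G ≃* K) :
    cyclicCount G = cyclicCount K :=
  Nat.card_congr (e.mapSubgroup.toEquiv.subtypeEquiv fun H =>
    (e.subgroupMap H).isCyclic)

theorem pow_eq_pow_of_modEq_natCard {A : Type*} [Group A] (x : A) {k l : ℕ}
    (hk : k ≡ l [MOD Nat.card A]) : x ^ k = x ^ l :=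
  pow_eq_pow_iff_modEq.2 (hk.of_dvd (_root_.orderOf_dvd_natCard x))

theorem Subgroup.prod_map_fst_map_snd_of_coprime {G K : Type*} [Group G] [Group K]
    (h : (Nat.card G).Coprime (Nat.card K)) (H : Subgroup (G × K)) :
    (H.map (MonoidHom.fst G K)).prod (H.map (MonoidHom.snd G K)) = H := by
  -- The exponents are projectors: `(x, y')ᵏ = (x, 1)` and `(x', y)ˡ = (1, y)`.
  obtain ⟨k, hk1, hk0⟩ := Nat.chineseRemainder h 1 0
  obtain ⟨l, hl0, hl1⟩ := Nat.chineseRemainder h 0 1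
  ext ⟨x, y⟩
  simp only [Subgroup.mem_prod, Subgroup.mem_map, MonoidHom.coe_fst, MonoidHom.coe_snd, Prod.exists,
    exists_and_right, exists_eq_right]
  constructor
  · rintro ⟨⟨y', hx⟩, ⟨x', hy⟩⟩
    have h1 := H.mul_mem (H.pow_mem hx k) (H.pow_mem hy l)
    simpa [pow_eq_pow_of_modEq_natCard x hk1, pow_eq_pow_of_modEq_natCard x' hl0,
      pow_eq_pow_of_modEq_natCard y' hk0, pow_eq_pow_of_modEq_natCard y hl1] using h1
  · exact fun hxy => ⟨⟨y, hxy⟩, ⟨x, hxy⟩⟩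

/-- Subgroups of a product of groups of coprime orders are products of subgroups. -/
noncomputable def Subgroup.prodEquivOfCoprime {G K : Type*} [Group G] [Group K]
    (h : (Nat.card G).Coprime (Nat.card K)) :
    Subgroup G × Subgroup K ≃ Subgroup (G × K) where
  toFun A := A.1.prod A.2
  invFun H := (H.map (MonoidHom.fst G K), H.map (MonoidHom.snd G K))
  left_inv A := by
    ext x
    · simpa [Subgroup.mem_prod] using fun _ => ⟨1, A.2.one_mem⟩
    · simpa [Subgroup.mem_prod] using fun _ => ⟨1, A.1.one_mem⟩
  right_inv H := prod_map_fst_map_snd_of_coprime h H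

theorem Subgroup.isCyclic_prod_iff_of_coprime {G K : Type*} [Group G] [Group K]
    (h : (Nat.card G).Coprime (Nat.card K)) (A : Subgroup G) (B : Subgroup K) :
    IsCyclic (A.prod B) ↔ IsCyclic A ∧ IsCyclic B := by
  rw [(A.prodEquiv B).isCyclic, Group.isCyclic_prod_iff]
  have : (Nat.card A).Coprime (Nat.card B) :=
    (h.coprime_dvd_left A.card_subgroup_dvd_card).coprime_dvd_right B.card_subgroup_dvd_card
  tauto

theorem cdeg_prod_of_coprime {G K : Type*} [Group G] [Group K]
    (h : (Nat.card G).Coprime (Nat.card K)) : cdeg (G × K) = cdeg G * cdeg K := by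
  have h1 : Nat.card (Subgroup (G × K)) = Nat.card (Subgroup G) * Nat.card (Subgroup K) := by
    rw [← Nat.card_prod, Nat.card_congr (Subgroup.prodEquivOfCoprime h)]
  have h2 : cyclicCount (G × K) = cyclicCount G * cyclicCount K := by
    rw [cyclicCount, cyclicCount, cyclicCount, ← Nat.card_prod]
    refine Nat.card_congr (Equiv.symm ?_)
    exact (Equiv.subtypeProdEquivProd).symm.trans
      ((Subgroup.prodEquivOfCoprime h).subtypeEquiv fun A =>
        (Subgroup.isCyclic_prod_iff_of_coprime h A.1 A.2).symm)
  rw [cdeg_eq, cdeg_eq, cdeg_eq, h1, h2]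
  push_cast
  rw [mul_div_mul_comm]

theorem cdeg_congr {G K : Type*} [Group G] [Group K] (e : G ≃* K) : cdeg G = cdeg K := by
  rw [cdeg_eq, cdeg_eq, card_subgroup_congr e, cyclicCount_congr e]

theorem cdegSq_mul {m n : ℕ} (h : m.Coprime n) : cdegSq (m * n) = cdegSq m * cdegSq n := by
  let e : ZMod (m * n) × ZMod (m * n) ≃+ (ZMod m × ZMod m) × (ZMod n × ZMod n) :=
    (AddEquiv.prodCongr (ZMod.chineseRemainder h).toAddEquiv
      (ZMod.chineseRemainder h).toAddEquiv).trans (AddEquiv.prodProdProdComm _ _ _ _)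
  let e' : Multiplicative (ZMod (m * n) × ZMod (m * n)) ≃*
      Multiplicative (ZMod m × ZMod m) × Multiplicative (ZMod n × ZMod n) :=
    e.toMultiplicative.trans (MulEquiv.prodMultiplicative _ _)
  rw [cdegSq, cdeg_congr e', cdeg_prod_of_coprime, cdegSq, cdegSq]
  simp only [Nat.card_congr Multiplicative.toAdd, Nat.card_prod, Nat.card_zmod]
  exact (h.mul_right h).mul_left (h.mul_right h)

/-! ### Counting cyclic subgroups through their generators -/

theorem card_filter_zpowers_eq {G : Type*} [Group G] [Fintype G] (H : Subgroup G) [hH : IsCyclic H]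
    [DecidablePred fun x : G => Subgroup.zpowers x = H] :
    (Finset.univ.filter fun x : G => Subgroup.zpowers x = H).card = (Nat.card H).totient := by
  classical
  have : Fintype H := Fintype.ofFinite H
  rw [← IsCyclic.card_orderOf_eq_totient (α := H) (d := Nat.card H)
    (by rw [Nat.card_eq_fintype_card])]
  symm
  refine Finset.card_nbij (fun x => (x : G)) ?_ (Subtype.val_injective.injOn) ?_
  · intro x hx
    have hx : orderOf x = Nat.card H := by simpa using hx
    simp only [Finset.coe_filter, Finset.mem_univ, true_and, Set.mem_ofPred_eq]
    refine Subgroup.eq_of_le_of_card_ge (by simp) ?_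
    rw [Nat.card_zpowers, Subgroup.orderOf_coe, hx]
  · intro x hx
    have hx : Subgroup.zpowers x = H := by simpa using hx
    refine ⟨⟨x, hx ▸ Subgroup.mem_zpowers x⟩, ?_, rfl⟩
    simp only [Finset.coe_filter, Finset.mem_univ, true_and, Set.mem_ofPred_eq,
      Subgroup.orderOf_mk, ← hx, Nat.card_zpowers]

/-- A cyclic subgroup of order `d` has `φ(d)` generators, so these weights give it total mass 1. -/
theorem cyclicCount_eq_sum {G : Type*} [Group G] [Fintype G] :
    (cyclicCount G : ℝ) = ∑ x : G, 1 / ((orderOf x).totient : ℝ) := by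
  classical
  have : Fintype (Subgroup G) := Fintype.ofFinite _
  rw [← Finset.sum_fiberwise (s := Finset.univ) (g := fun x : G => Subgroup.zpowers x)]
  have key : ∀ H : Subgroup G, (∑ x : G with Subgroup.zpowers x = H,
      1 / ((orderOf x).totient : ℝ)) = if IsCyclic H then 1 else 0 := by
    intro H
    split_ifs with hH
    · have : ∀ x ∈ Finset.univ.filter (fun x : G => Subgroup.zpowers x = H),
          1 / ((orderOf x).totient : ℝ) = 1 / ((Nat.card H).totient : ℝ) := by
        intro x hx
        rw [← (Finset.mem_filter.1 hx).2, Nat.card_zpowers]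
      rw [Finset.sum_congr rfl this, Finset.sum_const, card_filter_zpowers_eq, nsmul_eq_mul]
      have : ((Nat.card H).totient : ℝ) ≠ 0 :=
        Nat.cast_ne_zero.2 (Nat.totient_pos.2 Nat.card_pos).ne'
      field_simp
    · refine Finset.sum_eq_zero fun x hx => ?_
      rw [← (Finset.mem_filter.1 hx).2] at hH
      exact absurd (inferInstanceAs (IsCyclic (Subgroup.zpowers x))) hH
  rw [Finset.sum_congr rfl fun H _ => key H, cyclicCount, Finset.sum_boole,
    Nat.card_eq_fintype_card, Fintype.card_subtype]

/-- Each layer consists of the `p²ᵏ⁺² - p²ᵏ` elements of order `pᵏ⁺¹`; dividing by `φ(pᵏ⁺¹) = pᵏ(p -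
1)` gives `pᵏ⁺¹ + pᵏ`. -/
theorem sum_inv_totient_orderOf {G : Type*} [CommGroup G] [Fintype G] [DecidableEq G] {p a : ℕ}
    [hp : Fact p.Prime]
    (hcard : ∀ k ≤ a, (Finset.univ.filter fun x : G => x ^ p ^ k = 1).card = p ^ (2 * k)) :
    ∀ k ≤ a, ∑ x : G with x ^ p ^ k = 1, 1 / ((orderOf x).totient : ℝ) =
      1 + ∑ j ∈ Finset.range k, ((p : ℝ) ^ (j + 1) + (p : ℝ) ^ j)
  | 0, _ => by simp [Finset.filter_eq']
  | k + 1, hk => by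
    have hsub : (Finset.univ.filter fun x : G => x ^ p ^ k = 1) ⊆
        Finset.univ.filter fun x : G => x ^ p ^ (k + 1) = 1 := by
      intro x hx
      simp only [Finset.mem_filter, Finset.mem_univ, true_and] at hx ⊢
      rw [pow_succ, pow_mul, hx, one_pow]
    rw [← Finset.sum_sdiff hsub, sum_inv_totient_orderOf hcard k (by omega),
      Finset.sum_range_succ]
    have h1 : ∀ x ∈ (Finset.univ.filter fun x : G => x ^ p ^ (k + 1) = 1) \
        (Finset.univ.filter fun x : G => x ^ p ^ k = 1),
        1 / ((orderOf x).totient : ℝ) = 1 / ((p : ℝ) ^ k * (p - 1)) := by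
      intro x hx
      simp only [Finset.mem_sdiff, Finset.mem_filter, Finset.mem_univ, true_and] at hx
      rw [orderOf_eq_prime_pow hx.2 hx.1, Nat.totient_prime_pow_succ hp.out]
      push_cast [hp.out.one_le]
      rfl
    rw [Finset.sum_congr rfl h1, Finset.sum_const, Finset.card_sdiff_of_subset hsub,
      hcard k (by omega), hcard (k + 1) hk, nsmul_eq_mul,
      Nat.cast_sub (Nat.pow_le_pow_right hp.out.pos (by omega))]
    have h2 : (p : ℝ) - 1 ≠ 0 := by
      have : (1 : ℝ) < p := by exact_mod_cast hp.out.one_lt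
      linarith
    have h3 : (p : ℝ) ≠ 0 := by exact_mod_cast hp.out.ne_zero
    push_cast
    field_simp
    ring

/-! ### Non-cyclic subgroups and the p-torsion -/

theorem card_filter_pow_prime_pow_eq_one_le {G : Type*} [CommGroup G] [Fintype G] [DecidableEq G]
    {p : ℕ} (h : (Finset.univ.filter fun x : G => x ^ p = 1).card ≤ p) :
    ∀ k, (Finset.univ.filter fun x : G => x ^ p ^ k = 1).card ≤ p ^ k
  | 0 => by simp [Finset.filter_eq']
  | k + 1 => by
    have ih := card_filter_pow_prime_pow_eq_one_le h k
    have h1 := Finset.card_le_mul_card_image (f := fun x : G => x ^ p)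
      (Finset.univ.filter fun x : G => x ^ p ^ (k + 1) = 1) p (by
        intro b hb
        obtain ⟨y, -, rfl⟩ := Finset.mem_image.1 hb
        -- Translation by `y⁻¹` embeds the fibre of the p-th power map through `y` into the
        -- p-torsion.
        refine le_trans (Finset.card_le_card_of_injOn (fun x => x * y⁻¹) ?_
          (mul_left_injective _).injOn) h
        intro x hx
        have hx := (Finset.mem_filter.1 hx).2
        simp [mul_pow, hx])
    refine h1.trans ?_
    rw [pow_succ']
    refine Nat.mul_le_mul_left _ (le_trans (Finset.card_le_card ?_) ih)
    intro b hb
    obtain ⟨y, hy, rfl⟩ := Finset.mem_image.1 hb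
    simpa [← pow_mul, ← pow_succ'] using hy

/-- In a group of order `pⁿ`, solutions of `xᵐ = 1` are killed by `gcd(m, pⁿ)`, a power of `p`, so
bounding the p-power torsion verifies the root-counting criterion for cyclicity. -/
theorem isCyclic_of_card_filter_pow_prime_le {G : Type*} [CommGroup G] [Fintype G] [DecidableEq G]
    {p n : ℕ} [hp : Fact p.Prime] (hG : Nat.card G = p ^ n)
    (h : (Finset.univ.filter fun x : G => x ^ p = 1).card ≤ p) : IsCyclic G := by
  refine isCyclic_of_card_pow_eq_one_le fun m hm => ?_
  obtain ⟨k, -, hk⟩ := (Nat.dvd_prime_pow hp.out).1 (Nat.gcd_dvd_right m (p ^ n))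
  refine le_trans (le_trans (Finset.card_le_card ?_)
    (card_filter_pow_prime_pow_eq_one_le h k)) (hk ▸ Nat.gcd_le_left _ hm)
  intro x hx
  simp only [Finset.mem_filter, Finset.mem_univ, true_and] at hx ⊢
  rw [← hk]
  exact orderOf_dvd_iff_pow_eq_one.1
    (Nat.dvd_gcd (orderOf_dvd_of_pow_eq_one hx) (hG ▸ orderOf_dvd_natCard x))

/-- The p-torsion of `H` has order 1, `p` or `p²`: the first two force `H` cyclic, the last is the
full p-torsion of `G`, too large for a cyclic group. -/
theorem not_isCyclic_iff_torsion_le {G : Type*} [CommGroup G] [Finite G] {p : ℕ}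
    [hp : Fact p.Prime] (hG : IsPGroup p G) (hT : Nat.card (powMonoidHom (α := G) p).ker = p ^ 2)
    (H : Subgroup G) : ¬ IsCyclic H ↔ (powMonoidHom (α := G) p).ker ≤ H := by
  classical
  have : Fintype H := Fintype.ofFinite H
  let T := (powMonoidHom (α := G) p).ker
  have hcard : (Finset.univ.filter fun x : H => x ^ p = 1).card = Nat.card (H ⊓ T : Subgroup G) := by
    rw [← Fintype.card_subtype, ← Nat.card_eq_fintype_card]
    refine Nat.card_congr ⟨fun x => ⟨x.1, x.1.2, ?_⟩, fun x => ⟨⟨x.1, x.2.1⟩, ?_⟩,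
      fun _ => rfl, fun _ => rfl⟩
    · have := congrArg (Subtype.val) x.2
      simpa [T, MonoidHom.mem_ker] using this
    · have := x.2.2
      ext
      simpa [T, MonoidHom.mem_ker] using this
  constructor
  · intro hH
    obtain ⟨n, hn⟩ := IsPGroup.iff_card.1 (hG.to_subgroup H)
    have h1 : p < Nat.card (H ⊓ T : Subgroup G) := by
      by_contra hle
      exact hH (isCyclic_of_card_filter_pow_prime_le hn (by rw [hcard]; omega))
    have h2 : Nat.card (H ⊓ T : Subgroup G) ∣ p ^ 2 := hT ▸ Subgroup.card_dvd_of_le inf_le_right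
    obtain ⟨k, hk, hk'⟩ := (Nat.dvd_prime_pow hp.out).1 h2
    have hk2 : k = 2 := by
      have : p ^ 1 < p ^ k := by rw [← hk', pow_one]; exact h1
      have := (Nat.pow_lt_pow_iff_right hp.out.one_lt).1 this
      omega
    have h3 : H ⊓ T = T := Subgroup.eq_of_le_of_card_ge inf_le_right (by rw [hT, hk', hk2])
    exact inf_eq_right.1 h3
  · intro hle hH
    have h1 := IsCyclic.card_pow_eq_one_le (α := H) hp.out.pos
    rw [hcard, inf_eq_right.2 hle, hT] at h1
    nlinarith [hp.out.one_lt]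

/-- The non-cyclic subgroups are those containing `φ.ker`, hence correspond to the subgroups of `K`.
-/
theorem card_subgroup_eq_of_surjective {G K : Type*} [CommGroup G] [Finite G] [Group K] {p : ℕ}
    [hp : Fact p.Prime] (hG : IsPGroup p G) (hT : Nat.card (powMonoidHom (α := G) p).ker = p ^ 2)
    (φ : G →* K) (hφ : Function.Surjective φ) (hker : φ.ker = (powMonoidHom (α := G) p).ker) :
    Nat.card (Subgroup G) = cyclicCount G + Nat.card (Subgroup K) := by
  classical
  rw [← Nat.card_congr (Equiv.sumCompl fun H : Subgroup G => IsCyclic H), Nat.card_sum, cyclicCount]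
  congr 1
  refine Nat.card_congr ⟨fun H => H.1.map φ, fun A => ⟨A.comap φ, ?_⟩, fun H => ?_, fun A => ?_⟩
  · rw [not_isCyclic_iff_torsion_le hG hT, ← hker]
    exact φ.ker_le_comap A
  · have h := (not_isCyclic_iff_torsion_le hG hT H.1).1 H.2
    exact Subtype.ext (Subgroup.comap_map_eq_self (hker ▸ h))
  · exact Subgroup.map_comap_eq_self_of_surjective hφ A

/-! ### Subgroup counts and cyclicity degree of (ℤ/pᵃ)² -/

theorem card_nsmul_eq_zero_zmod {n d : ℕ} [NeZero n] (hd : d ∣ n) :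
    Nat.card {x : ZMod n // d • x = 0} = d := by
  have := IsAddCyclic.card_nsmulAddMonoidHom_ker (ZMod n) d
  rw [Nat.card_zmod, Nat.gcd_eq_right hd] at this
  exact this

theorem card_pow_eq_one_zmod_sq {n d : ℕ} [NeZero n] (hd : d ∣ n) :
    Nat.card {x : Multiplicative (ZMod n × ZMod n) // x ^ d = 1} = d ^ 2 := by
  rw [pow_two]
  conv_rhs => rw [← card_nsmul_eq_zero_zmod hd, ← Nat.card_prod]
  refine Nat.card_congr ((Multiplicative.toAdd.subtypeEquiv fun x => ?_).trans
    Equiv.subtypeProdEquivProd)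
  rw [← Prod.mk_eq_zero]
  rfl

theorem castHom_eq_zero_iff_nsmul {p a : ℕ} (hp : p.Prime) (x : ZMod (p ^ (a + 1))) :
    ZMod.castHom (pow_dvd_pow p a.le_succ) (ZMod (p ^ a)) x = 0 ↔ p • x = 0 := by
  have : NeZero (p ^ (a + 1)) := ⟨(pow_pos hp.pos _).ne'⟩
  obtain ⟨k, rfl⟩ := ZMod.natCast_zmod_surjective x
  rw [map_natCast, ZMod.natCast_eq_zero_iff, nsmul_eq_mul, ← Nat.cast_mul,
    ZMod.natCast_eq_zero_iff, pow_succ', Nat.mul_dvd_mul_iff_left hp.pos]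

theorem card_subgroup_zmod_prime_pow_sq_succ {p : ℕ} (hp : p.Prime) (a : ℕ) :
    Nat.card (Subgroup (Multiplicative (ZMod (p ^ (a + 1)) × ZMod (p ^ (a + 1))))) =
      cyclicCount (Multiplicative (ZMod (p ^ (a + 1)) × ZMod (p ^ (a + 1)))) +
        Nat.card (Subgroup (Multiplicative (ZMod (p ^ a) × ZMod (p ^ a)))) := by
  have : Fact p.Prime := ⟨hp⟩
  let ψ : ZMod (p ^ (a + 1)) →+ ZMod (p ^ a) :=
    (ZMod.castHom (pow_dvd_pow p a.le_succ) (ZMod (p ^ a))).toAddMonoidHom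
  have hψ : Function.Surjective ψ := ZMod.castHom_surjective (pow_dvd_pow p a.le_succ)
  refine card_subgroup_eq_of_surjective (p := p) ?_ ?_ (AddMonoidHom.toMultiplicative (ψ.prodMap ψ))
    (Function.Surjective.prodMap hψ hψ) ?_
  · refine IsPGroup.of_card (n := 2 * (a + 1)) ?_
    rw [Nat.card_congr Multiplicative.toAdd, Nat.card_prod, Nat.card_zmod]
    ring
  · exact card_pow_eq_one_zmod_sq (dvd_pow_self p a.succ_ne_zero)
  · ext x
    change (ψ x.toAdd.1, ψ x.toAdd.2) = 0 ↔ (p • x.toAdd.1, p • x.toAdd.2) = 0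
    rw [Prod.mk_eq_zero, Prod.mk_eq_zero]
    exact and_congr (castHom_eq_zero_iff_nsmul hp _) (castHom_eq_zero_iff_nsmul hp _)

theorem cyclicCount_zmod_prime_pow_sq {p : ℕ} (hp : p.Prime) (a : ℕ) :
    (cyclicCount (Multiplicative (ZMod (p ^ a) × ZMod (p ^ a))) : ℝ) =
      1 + ∑ j ∈ Finset.range a, ((p : ℝ) ^ (j + 1) + (p : ℝ) ^ j) := by
  have : Fact p.Prime := ⟨hp⟩
  have : Fintype (Multiplicative (ZMod (p ^ a) × ZMod (p ^ a))) := Fintype.ofFinite _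
  classical
  rw [cyclicCount_eq_sum, ← sum_inv_totient_orderOf (p := p) (a := a)
    (G := Multiplicative (ZMod (p ^ a) × ZMod (p ^ a))) ?_ a le_rfl]
  · refine (Finset.sum_congr (Finset.filter_true_of_mem fun x _ => ?_) fun _ _ => rfl).symm
    have h0 : (p : ZMod (p ^ a)) ^ a = 0 := by exact_mod_cast ZMod.natCast_self (p ^ a)
    have h : p ^ a • x.toAdd = 0 := by ext <;> simp [h0]
    exact h
  · intro k hk
    rw [← Fintype.card_subtype, ← Nat.card_eq_fintype_card,
      card_pow_eq_one_zmod_sq (pow_dvd_pow p hk)]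
    ring

/-- The number of subgroups of `(ℤ/pᵃℤ)²`. -/
def primePowSubgroupCount (p : ℕ) : ℕ → ℕ
  | 0 => 1
  | a + 1 => p * primePowSubgroupCount p a + (2 * a + 3)

theorem mul_add_two_eq_sum_range_succ (p : ℝ) (a : ℕ) :
    p * (1 + ∑ j ∈ Finset.range a, (p ^ (j + 1) + p ^ j)) + 2 =
      1 + ∑ j ∈ Finset.range (a + 1), (p ^ (j + 1) + p ^ j) := by
  induction a with
  | zero => simp; ring
  | succ a ih =>
    rw [Finset.sum_range_succ _ (a + 1)]
    linear_combination ih + p * Finset.sum_range_succ (fun j => p ^ (j + 1) + p ^ j) a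

theorem card_subgroup_zmod_prime_pow_sq {p : ℕ} (hp : p.Prime) (a : ℕ) :
    Nat.card (Subgroup (Multiplicative (ZMod (p ^ a) × ZMod (p ^ a)))) =
      primePowSubgroupCount p a := by
  -- The second conjunct expresses the cyclic count at level `a + 1` through `U a`, turning `U (a+1)
  -- = cyclic count + U a` into the recursion.
  suffices h : (Nat.card (Subgroup (Multiplicative (ZMod (p ^ a) × ZMod (p ^ a)))) : ℝ) =
        primePowSubgroupCount p a ∧
      (p - 1 : ℝ) * primePowSubgroupCount p a + (2 * a + 3) =
        1 + ∑ j ∈ Finset.range (a + 1), ((p : ℝ) ^ (j + 1) + (p : ℝ) ^ j) by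
    exact_mod_cast h.1
  induction a with
  | zero =>
    constructor
    · have : Subsingleton (Multiplicative (ZMod (p ^ 0) × ZMod (p ^ 0))) :=
        inferInstanceAs (Subsingleton (ZMod 1 × ZMod 1))
      rw [Nat.card_of_subsingleton ⊥]
      rfl
    · simp [primePowSubgroupCount]; ring
  | succ a ih =>
    constructor
    · rw [card_subgroup_zmod_prime_pow_sq_succ hp, Nat.cast_add, cyclicCount_zmod_prime_pow_sq hp,
        ih.1, ← ih.2, primePowSubgroupCount]
      push_cast
      ring
    · rw [← mul_add_two_eq_sum_range_succ, ← ih.2, primePowSubgroupCount]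
      push_cast
      ring

theorem cdegSq_prime_pow_succ {p : ℕ} (hp : p.Prime) (a : ℕ) :
    cdegSq (p ^ (a + 1)) =
      1 - (primePowSubgroupCount p a : ℝ) / primePowSubgroupCount p (a + 1) := by
  have h := card_subgroup_zmod_prime_pow_sq_succ hp a
  rw [card_subgroup_zmod_prime_pow_sq hp, card_subgroup_zmod_prime_pow_sq hp] at h
  rw [cdegSq, cdeg_eq, card_subgroup_zmod_prime_pow_sq hp]
  have h0 : (primePowSubgroupCount p (a + 1) : ℝ) ≠ 0 := by
    simp only [primePowSubgroupCount]; positivity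
  rw [eq_sub_iff_add_eq, ← add_div, div_eq_one_iff_eq h0]
  exact_mod_cast h.symm

theorem cdegSq_one : cdegSq 1 = 1 := by
  have h := card_subgroup_zmod_prime_pow_sq Nat.prime_two 0
  have h' := cyclicCount_zmod_prime_pow_sq Nat.prime_two 0
  rw [pow_zero] at h h'
  rw [cdegSq, cdeg_eq, h, h']
  simp [primePowSubgroupCount]

/-! ### Mean value of g * ζ when n |g(n)| is bounded by d₃(n) -/

open scoped ArithmeticFunction.zeta ArithmeticFunction.Moebius in
theorem hasSum_zeta_cube_div_rpow {t : ℝ} (ht : 1 < t) :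
    HasSum (fun n : ℕ => ((ζ * ζ * ζ : ArithmeticFunction ℕ) n : ℝ) / (n : ℝ) ^ t)
      ((riemannZeta t ^ 3).re) := by
  have hz : LSeriesHasSum (fun n => ((ζ : ArithmeticFunction ℂ)) n) (t : ℂ) (riemannZeta t) := by
    refine (LSeriesHasSum_congr (t : ℂ) (riemannZeta t) fun {n} hn => ?_).1
      (ArithmeticFunction.LSeriesHasSum_zeta (s := t) (by simpa using ht))
    rfl
  have h3 := ArithmeticFunction.LSeriesHasSum_mul (ArithmeticFunction.LSeriesHasSum_mul hz hz) hz
  have h4 := Complex.hasSum_re h3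
  rw [show riemannZeta t ^ 3 = riemannZeta t * riemannZeta t * riemannZeta t by ring]
  refine h4.congr_fun fun n => ?_
  rcases eq_or_ne n 0 with rfl | hn
  · simp
  rw [LSeries.term_of_ne_zero hn, ← ArithmeticFunction.natCoe_mul, ← ArithmeticFunction.natCoe_mul,
    ArithmeticFunction.natCoe_apply, ← Complex.ofReal_natCast, ← Complex.ofReal_natCast,
    ← Complex.ofReal_cpow n.cast_nonneg, ← Complex.ofReal_div, Complex.ofReal_re]

/-- The pole of zeta at 1 is simple. -/
theorem isBigO_riemannZeta_one_add_inv_log :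
    (fun x : ℝ => riemannZeta ((1 + 1 / Real.log x : ℝ) : ℂ)) =O[atTop] Real.log := by
  have h0 : Tendsto (fun x : ℝ => 1 / Real.log x) atTop (nhds 0) := by
    simp only [one_div]
    exact Real.tendsto_log_atTop.inv_tendsto_atTop
  have hpos := Real.tendsto_log_atTop.eventually_gt_atTop 0
  have h1 : Tendsto (fun x : ℝ => ((1 + 1 / Real.log x : ℝ) : ℂ)) atTop (nhdsWithin 1 {1}ᶜ) := by
    refine tendsto_nhdsWithin_iff.2 ⟨?_, ?_⟩
    · have h := (Complex.continuous_ofReal.tendsto _).comp (h0.const_add 1)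
      rw [add_zero, Complex.ofReal_one] at h
      exact h
    · filter_upwards [hpos] with x hx h
      have h' : (1 + 1 / Real.log x) = 1 := by exact_mod_cast Set.mem_singleton_iff.1 h
      have : 0 < 1 / Real.log x := by positivity
      linarith
  have h2 := (riemannZeta_residue_one.comp h1).isBigO_one ℝ
  have h4 : (fun x : ℝ => (Real.log x : ℂ)) =O[atTop] Real.log :=
    IsBigO.of_bound 1 (Eventually.of_forall fun x => by simp)
  refine ((h4.mul h2).congr' ?_ (Eventually.of_forall fun x => mul_one _))
  filter_upwards [hpos] with x hx
  have : (Real.log x : ℂ) ≠ 0 := by exact_mod_cast hx.ne'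
  simp only [Function.comp_apply]
  push_cast
  field_simp
  ring_nf

/-- The error is below 1 when `y ≥ 1` and equals `y` when `y < 1`. One power bound thus covers both
the fractional parts (`d ≤ x`) and the tail of the series (`d > x`). -/
theorem abs_natFloor_sub_le_rpow {y s : ℝ} (hy : 0 ≤ y) (hs0 : 0 ≤ s) (hs1 : s ≤ 1) :
    |(⌊y⌋₊ : ℝ) - y| ≤ y ^ s := by
  have h1 := Nat.floor_le hy
  have h2 := Nat.lt_floor_add_one y
  rw [abs_sub_comm, abs_of_nonneg (by linarith)]
  rcases le_total 1 y with h | h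
  · linarith [Real.one_le_rpow h hs0]
  · rcases hy.eq_or_lt with rfl | hy
    · simpa using Real.rpow_nonneg le_rfl s
    · have := Real.rpow_le_rpow_of_exponent_ge hy h hs1
      rw [Real.rpow_one] at this
      linarith [(Nat.cast_nonneg ⌊y⌋₊ : (0 : ℝ) ≤ _)]

open scoped ArithmeticFunction.zeta in
theorem summable_div_of_abs_mul_le {g : ArithmeticFunction ℝ}
    (hg : ∀ n, |g n| * n ≤ (ζ * ζ * ζ : ArithmeticFunction ℕ) n) :
    Summable fun n : ℕ => ‖g n / n‖ := by
  refine Summable.of_nonneg_of_le (fun _ => norm_nonneg _) (fun n => ?_)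
    (hasSum_zeta_cube_div_rpow (t := 2) (by norm_num)).summable
  rcases eq_or_ne n 0 with rfl | hn
  · simp
  have hn' : (0 : ℝ) < n := by positivity
  rw [Real.norm_eq_abs, abs_div, abs_of_pos hn', Real.rpow_two, div_le_div_iff₀ hn' (by positivity)]
  nlinarith [hg n]

-- Rankin's trick with `s = 1 / log x`: since `xˢ = e`, the error is at most `∑ |g d| (x/d)ˢ ≤ e ∑
-- d₃(d) / d¹⁺ˢ`.
open scoped ArithmeticFunction.zeta in
theorem abs_sum_mul_zeta_sub_le {g : ArithmeticFunction ℝ}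
    (hg : ∀ n, |g n| * n ≤ (ζ * ζ * ζ : ArithmeticFunction ℕ) n) {x : ℝ} (hx : Real.exp 1 ≤ x) :
    |∑ n ∈ Finset.Ioc 0 ⌊x⌋₊, (g * (ζ : ArithmeticFunction ℝ)) n - (∑' n, g n / n) * x| ≤
      Real.exp 1 * ‖riemannZeta ((1 + 1 / Real.log x : ℝ) : ℂ)‖ ^ 3 := by
  have hx0 : 0 < x := (Real.exp_pos 1).trans_le hx
  have hlog : 1 ≤ Real.log x := (Real.le_log_iff_exp_le hx0).2 hx
  set s := 1 / Real.log x with hs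
  have hs0 : 0 < s := by positivity
  have hs1 : s ≤ 1 := by rw [hs, div_le_one (by linarith)]; exact hlog
  have hxs : x ^ s = Real.exp 1 := by
    rw [Real.rpow_def_of_pos hx0, hs, mul_one_div_cancel (by linarith)]
  -- The sum extends to all `d` because `⌊x/d⌋ = 0` for `d > x`.
  have e1 : HasSum (fun d : ℕ => g d * (⌊x / d⌋₊ : ℝ))
      (∑ n ∈ Finset.Ioc 0 ⌊x⌋₊, (g * (ζ : ArithmeticFunction ℝ)) n) := by
    rw [ArithmeticFunction.sum_Ioc_mul_zeta_eq_sum]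
    have := hasSum_sum_of_ne_finset_zero (L := .unconditional ℕ) (f := fun d : ℕ => g d * (⌊x / d⌋₊ : ℝ))
      (s := Finset.Ioc 0 ⌊x⌋₊) (by
        intro d hd
        rw [Nat.floor_div_natCast]
        rcases eq_or_ne d 0 with rfl | hd0
        · simp
        · have : ⌊x⌋₊ < d := by
            by_contra h
            exact hd (Finset.mem_Ioc.2 ⟨Nat.pos_of_ne_zero hd0, not_lt.1 h⟩)
          simp [Nat.div_eq_of_lt this])
    simpa only [Nat.floor_div_natCast] using this
  have e2 : HasSum (fun d : ℕ => g d / d * x) ((∑' n, g n / n) * x) :=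
    ((summable_div_of_abs_mul_le hg).of_norm.hasSum).mul_right x
  have e3 := (hasSum_zeta_cube_div_rpow (t := 1 + s) (by linarith)).mul_left (Real.exp 1)
  rw [← (e1.sub e2).tsum_eq, ← Real.norm_eq_abs]
  refine (tsum_of_norm_bounded e3 fun d => ?_).trans ?_
  · rcases eq_or_ne d 0 with rfl | hd
    · simp
    have hd' : (0 : ℝ) < d := by positivity
    have h1 := abs_natFloor_sub_le_rpow (div_nonneg hx0.le hd'.le) hs0.le hs1
    rw [show g d * (⌊x / d⌋₊ : ℝ) - g d / d * x = g d * ((⌊x / d⌋₊ : ℝ) - x / d) by ring,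
      norm_mul, Real.norm_eq_abs, Real.norm_eq_abs, Real.rpow_add hd', Real.rpow_one]
    rw [Real.div_rpow hx0.le hd'.le, hxs] at h1
    calc |g d| * |(⌊x / d⌋₊ : ℝ) - x / d|
        ≤ |g d| * (Real.exp 1 / (d : ℝ) ^ s) := by gcongr
      _ = Real.exp 1 * ((|g d| * d) / (d * (d : ℝ) ^ s)) := by field_simp
      _ ≤ _ := by gcongr; exact hg d
  · rw [← norm_pow]
    gcongr
    exact Complex.re_le_norm _

open scoped ArithmeticFunction.zeta in
theorem sum_mul_zeta_sub_isBigO {g : ArithmeticFunction ℝ}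
    (hg : ∀ n, |g n| * n ≤ (ζ * ζ * ζ : ArithmeticFunction ℕ) n) :
    (fun x : ℝ => ∑ n ∈ Finset.Ioc 0 ⌊x⌋₊, (g * (ζ : ArithmeticFunction ℝ)) n -
      (∑' n, g n / n) * x) =O[atTop] (fun x : ℝ => Real.log x ^ 3) := by
  refine IsBigO.trans (IsBigO.of_bound (Real.exp 1) ?_)
    (isBigO_riemannZeta_one_add_inv_log.norm_left.pow 3)
  filter_upwards [eventually_ge_atTop (Real.exp 1)] with x hx
  simpa using abs_sum_mul_zeta_sub_le hg hx

/-! ### Bounds and monotonicity of the non-cyclic proportion -/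

theorem pow_le_primePowSubgroupCount (p a : ℕ) : p ^ a ≤ primePowSubgroupCount p a := by
  induction a with
  | zero => simp [primePowSubgroupCount]
  | succ a ih =>
    rw [primePowSubgroupCount, pow_succ']
    exact (Nat.mul_le_mul_left p ih).trans (Nat.le_add_right _ _)

theorem primePowSubgroupCount_pos (p a : ℕ) : (0 : ℝ) < primePowSubgroupCount p a := by
  cases a with
  | zero => simp [primePowSubgroupCount]
  | succ a => simp only [primePowSubgroupCount]; positivity

/-- The proportion of non-cyclic subgroups of `(ℤ/pᵃℤ)²`. -/
noncomputable def primePowRatio (p : ℕ) : ℕ → ℝ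
  | 0 => 0
  | a + 1 => (primePowSubgroupCount p a : ℝ) / primePowSubgroupCount p (a + 1)

theorem cdegSq_prime_pow {p : ℕ} (hp : p.Prime) (a : ℕ) :
    cdegSq (p ^ a) = 1 - primePowRatio p a := by
  cases a with
  | zero => simp [cdegSq_one, primePowRatio]
  | succ a => exact cdegSq_prime_pow_succ hp a

theorem primePowRatio_nonneg (p a : ℕ) : 0 ≤ primePowRatio p a := by
  cases a with
  | zero => exact le_rfl
  | succ a => exact div_nonneg (Nat.cast_nonneg _) (Nat.cast_nonneg _)

theorem primePowRatio_le {p : ℕ} (hp : 0 < p) (a : ℕ) : primePowRatio p a ≤ 1 / p := by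
  have hp' : (0 : ℝ) < p := by exact_mod_cast hp
  cases a with
  | zero => simp [primePowRatio]
  | succ a =>
    rw [primePowRatio, div_le_div_iff₀ (primePowSubgroupCount_pos p _) hp']
    simp only [primePowSubgroupCount]
    push_cast
    nlinarith [(Nat.cast_nonneg a : (0 : ℝ) ≤ a)]

/-- Expanding the numerator `U (a+1)² - U a * U (a+2)` by the recursion cancels the terms in `p`,
leaving an expression linear in the counts. -/
theorem primePowRatio_sub (p a : ℕ) :
    primePowRatio p (a + 2) - primePowRatio p (a + 1) =
      ((2 * a + 3) * primePowSubgroupCount p (a + 1) - (2 * a + 5) * primePowSubgroupCount p a) /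
        (primePowSubgroupCount p (a + 1) * primePowSubgroupCount p (a + 2)) := by
  have h1 := (primePowSubgroupCount_pos p (a + 1)).ne'
  have h2 := (primePowSubgroupCount_pos p (a + 2)).ne'
  have e1 : (primePowSubgroupCount p (a + 1) : ℝ) = p * primePowSubgroupCount p a + (2 * a + 3) := by
    simp [primePowSubgroupCount]
  have e2 : (primePowSubgroupCount p (a + 2) : ℝ) =
      p * primePowSubgroupCount p (a + 1) + (2 * a + 5) := by
    rw [primePowSubgroupCount]; push_cast; ring
  rw [primePowRatio, primePowRatio]
  field_simp
  rw [e2, e1]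
  ring

theorem two_mul_primePowSubgroupCount_le {p : ℕ} (hp : 2 ≤ p) (a : ℕ) :
    2 * (primePowSubgroupCount p a : ℝ) ≤ primePowSubgroupCount p (a + 1) := by
  have : 2 * primePowSubgroupCount p a ≤ primePowSubgroupCount p (a + 1) := by
    rw [primePowSubgroupCount]
    exact (Nat.mul_le_mul_right _ hp).trans (Nat.le_add_right _ _)
  exact_mod_cast this

theorem primePowRatio_monotone {p : ℕ} (hp : 2 ≤ p) : Monotone (primePowRatio p) := by
  refine monotone_nat_of_le_succ fun a => ?_
  cases a with
  | zero => exact primePowRatio_nonneg p 1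
  | succ a =>
    rw [← sub_nonneg, primePowRatio_sub]
    have h := two_mul_primePowSubgroupCount_le hp a
    have h0 := primePowSubgroupCount_pos p a
    refine div_nonneg ?_ (mul_nonneg (Nat.cast_nonneg _) (Nat.cast_nonneg _))
    nlinarith [(Nat.cast_nonneg a : (0 : ℝ) ≤ a)]

theorem primePowRatio_sub_mul_pow_le {p : ℕ} (a : ℕ) :
    (primePowRatio p (a + 1) - primePowRatio p a) * p ^ (a + 1) ≤ 2 * a + 1 := by
  have hU : ((p : ℝ) ^ (a + 1)) ≤ primePowSubgroupCount p (a + 1) := by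
    exact_mod_cast pow_le_primePowSubgroupCount p (a + 1)
  have hU0 := primePowSubgroupCount_pos p (a + 1)
  suffices h : primePowRatio p (a + 1) - primePowRatio p a ≤
      (2 * a + 1) / primePowSubgroupCount p (a + 1) by
    calc _ ≤ (2 * a + 1) / primePowSubgroupCount p (a + 1) * (p : ℝ) ^ (a + 1) := by gcongr
      _ ≤ (2 * a + 1) / primePowSubgroupCount p (a + 1) * primePowSubgroupCount p (a + 1) := by
        gcongr
      _ = 2 * a + 1 := div_mul_cancel₀ _ hU0.ne'
  cases a with
  | zero => simp [primePowRatio, primePowSubgroupCount]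
  | succ a =>
    have h1 := primePowSubgroupCount_pos p (a + 1)
    have h0 := primePowSubgroupCount_pos p a
    rw [primePowRatio_sub, div_le_div_iff₀ (mul_pos h1 hU0) hU0]
    push_cast
    nlinarith [mul_nonneg (by positivity : (0 : ℝ) ≤ 2 * a + 5)
      (mul_pos h0 hU0).le]

/-! ### Möbius transform, Euler product and asymptotics -/

open scoped ArithmeticFunction.zeta ArithmeticFunction.Moebius

/-- The cyclicity degree of `(ℤ/nℤ)²` as an arithmetic function. -/
noncomputable def cdegSqFun : ArithmeticFunction ℝ := ⟨fun n => if n = 0 then 0 else cdegSq n, if_pos rfl⟩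

theorem cdegSqFun_apply {n : ℕ} (hn : n ≠ 0) : cdegSqFun n = cdegSq n := if_neg hn

theorem cdegSqFun_isMultiplicative : cdegSqFun.IsMultiplicative := by
  refine ArithmeticFunction.IsMultiplicative.iff_ne_zero.2
    ⟨(cdegSqFun_apply one_ne_zero).trans cdegSq_one, fun {m n} hm hn h => ?_⟩
  rw [cdegSqFun_apply hm, cdegSqFun_apply hn, cdegSqFun_apply (mul_ne_zero hm hn), cdegSq_mul h]

/-- The Möbius transform of `cdegSqFun`. -/
noncomputable def cdegSqMoebius : ArithmeticFunction ℝ := cdegSqFun * (μ : ArithmeticFunction ℝ)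

theorem cdegSqMoebius_mul_zeta : cdegSqMoebius * (ζ : ArithmeticFunction ℝ) = cdegSqFun := by
  rw [cdegSqMoebius, mul_assoc, ArithmeticFunction.coe_moebius_mul_coe_zeta, mul_one]

theorem cdegSqMoebius_isMultiplicative : cdegSqMoebius.IsMultiplicative :=
  cdegSqFun_isMultiplicative.mul ArithmeticFunction.isMultiplicative_moebius.intCast

theorem cdegSqMoebius_prime_pow_succ {p : ℕ} (hp : p.Prime) (a : ℕ) :
    cdegSqMoebius (p ^ (a + 1)) = primePowRatio p a - primePowRatio p (a + 1) := by
  have key : ∀ k, cdegSq (p ^ k) = ∑ i ∈ Finset.range (k + 1), cdegSqMoebius (p ^ i) := fun k => by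
    rw [← cdegSqFun_apply (pow_ne_zero k hp.ne_zero), ← cdegSqMoebius_mul_zeta,
      ArithmeticFunction.coe_mul_zeta_apply, Nat.sum_divisors_prime_pow hp]
  have h := key (a + 1)
  rw [Finset.sum_range_succ, ← key, cdegSq_prime_pow hp, cdegSq_prime_pow hp] at h
  linarith

theorem zeta_cube_prime_pow_ge {p : ℕ} (hp : p.Prime) (a : ℕ) :
    2 * a + 1 ≤ (ζ * ζ * ζ : ArithmeticFunction ℕ) (p ^ (a + 1)) := by
  have h2 : ∀ k, (ζ * ζ : ArithmeticFunction ℕ) (p ^ k) = k + 1 := fun k => by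
    rw [ArithmeticFunction.mul_zeta_apply, Nat.sum_divisors_prime_pow hp]
    simp [hp.ne_zero]
  rw [ArithmeticFunction.mul_zeta_apply, Nat.sum_divisors_prime_pow hp]
  simp only [h2]
  induction a with
  | zero => simp [Finset.sum_range_succ]
  | succ a ih => 
    rw [Finset.sum_range_succ]
    exact le_trans (by omega) (Nat.add_le_add_right ih _)

theorem zeta_cube_isMultiplicative : (ζ * ζ * ζ : ArithmeticFunction ℕ).IsMultiplicative :=
  (ArithmeticFunction.isMultiplicative_zeta.mul ArithmeticFunction.isMultiplicative_zeta).mul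
    ArithmeticFunction.isMultiplicative_zeta

/-- Both sides are multiplicative; at `pᵃ⁺¹` the left is at most `2a + 1`, the right at least that.
-/
theorem abs_cdegSqMoebius_mul_le (n : ℕ) :
    |cdegSqMoebius n| * n ≤ (ζ * ζ * ζ : ArithmeticFunction ℕ) n := by
  induction n using Nat.recOnPosPrimePosCoprime with
  | zero => simp
  | one => simp [cdegSqMoebius_isMultiplicative.map_one, zeta_cube_isMultiplicative.map_one]
  | prime_pow p k hp hk =>
    obtain ⟨a, rfl⟩ := Nat.exists_eq_succ_of_ne_zero hk.ne'
    rw [Nat.succ_eq_add_one, cdegSqMoebius_prime_pow_succ hp, abs_sub_comm,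
      abs_of_nonneg (sub_nonneg.2 (primePowRatio_monotone hp.two_le a.le_succ))]
    push_cast
    refine (primePowRatio_sub_mul_pow_le a).trans ?_
    exact_mod_cast zeta_cube_prime_pow_ge hp a
  | coprime m n hm hn h ihm ihn =>
    rw [cdegSqMoebius_isMultiplicative.map_mul_of_coprime h,
      zeta_cube_isMultiplicative.map_mul_of_coprime h, abs_mul]
    push_cast
    calc _ = (|cdegSqMoebius m| * m) * (|cdegSqMoebius n| * n) := by ring
      _ ≤ _ := mul_le_mul ihm ihn (by positivity) (Nat.cast_nonneg _)

theorem summable_primePowRatio_div_pow {p : ℕ} (hp : p.Prime) :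
    Summable fun a : ℕ => primePowRatio p a / (p : ℝ) ^ a := by
  have h1 : (1 : ℝ) < p := by exact_mod_cast hp.one_lt
  refine Summable.of_nonneg_of_le (fun a => div_nonneg (primePowRatio_nonneg p a) (by positivity))
    (fun a => ?_) (summable_geometric_of_lt_one (r := 1 / (p : ℝ)) (by positivity)
      ((div_lt_one (by positivity)).2 h1))
  rw [one_div_pow]
  gcongr
  exact (primePowRatio_le hp.pos a).trans ((div_le_one (by positivity)).2 h1.le)

theorem hasSum_cdegSq_prime_pow_div {p : ℕ} (hp : p.Prime) :
    HasSum (fun a : ℕ => cdegSq (p ^ a) / (p : ℝ) ^ a)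
      ((1 - 1 / (p : ℝ))⁻¹ - ∑' a, primePowRatio p a / (p : ℝ) ^ a) := by
  have h1 : (1 : ℝ) < p := by exact_mod_cast hp.one_lt
  have hg := hasSum_geometric_of_lt_one (r := 1 / (p : ℝ)) (by positivity)
    ((div_lt_one (by positivity)).2 h1)
  refine (hg.sub (summable_primePowRatio_div_pow hp).hasSum).congr_fun fun a => ?_
  rw [cdegSq_prime_pow hp, one_div_pow, sub_div]

theorem one_sub_mul_tsum_cdegSq {p : ℕ} (hp : p.Prime) :
    (1 - 1 / (p : ℝ)) * ∑' a : ℕ, cdegSq (p ^ a) / (p : ℝ) ^ a =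
      1 - (1 - 1 / (p : ℝ)) * ∑' a, primePowRatio p a / (p : ℝ) ^ a := by
  have h1 : (1 : ℝ) < p := by exact_mod_cast hp.one_lt
  have : 1 - 1 / (p : ℝ) ≠ 0 := by
    have := (div_lt_one (by positivity)).2 h1
    linarith
  rw [(hasSum_cdegSq_prime_pow_div hp).tsum_eq, mul_sub, mul_inv_cancel₀ this]

/-- Convolution with `μ` multiplies the local series by `1 - 1/p`; here this is a shift of index in
`∑ r a / pᵃ`, using `r 0 = 0`. -/
theorem tsum_cdegSqMoebius_prime_pow {p : ℕ} (hp : p.Prime) :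
    ∑' a : ℕ, cdegSqMoebius (p ^ a) / ((p ^ a : ℕ) : ℝ) =
      (1 - 1 / (p : ℝ)) * ∑' a : ℕ, cdegSq (p ^ a) / (p : ℝ) ^ a := by
  have hp0 : (p : ℝ) ≠ 0 := by exact_mod_cast hp.ne_zero
  have hs := summable_primePowRatio_div_pow hp
  have e : ∀ a : ℕ, cdegSqMoebius (p ^ (a + 1)) / ((p ^ (a + 1) : ℕ) : ℝ) =
      1 / p * (primePowRatio p a / (p : ℝ) ^ a) - primePowRatio p (a + 1) / (p : ℝ) ^ (a + 1) := by
    intro a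
    rw [cdegSqMoebius_prime_pow_succ hp]
    push_cast
    field_simp
    ring
  have hs1 := (summable_nat_add_iff 1).2 hs
  have hsum : Summable fun a : ℕ => cdegSqMoebius (p ^ a) / ((p ^ a : ℕ) : ℝ) := by
    refine (summable_nat_add_iff 1).1 ?_
    simp only [e]
    exact (hs.mul_left _).sub hs1
  rw [one_sub_mul_tsum_cdegSq hp, hsum.tsum_eq_zero_add]
  simp only [e]
  rw [(hs.mul_left _).tsum_sub hs1, tsum_mul_left]
  have h0 := hs.tsum_eq_zero_add
  rw [show primePowRatio p 0 = 0 from rfl, zero_div, zero_add] at h0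
  simp only [pow_zero, cdegSqMoebius_isMultiplicative.map_one, Nat.cast_one, div_one]
  linarith

theorem hasProd_one_sub_mul_tsum_cdegSq :
    HasProd (fun p : Nat.Primes =>
        (1 - 1 / (p : ℝ)) * ∑' a : ℕ, cdegSq ((p : ℕ) ^ a) / (p : ℝ) ^ a)
      (∑' n, cdegSqMoebius n / n) := by
  have h := EulerProduct.eulerProduct_hasProd (f := fun n : ℕ => cdegSqMoebius n / (n : ℝ))
    (by simp [cdegSqMoebius_isMultiplicative.map_one])
    (fun {m n} hmn => by
      rw [cdegSqMoebius_isMultiplicative.map_mul_of_coprime hmn, Nat.cast_mul, mul_div_mul_comm])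
    (summable_div_of_abs_mul_le abs_cdegSqMoebius_mul_le) (by simp)
  refine h.congr_fun fun p => ?_
  exact (tsum_cdegSqMoebius_prime_pow p.2).symm

theorem sum_cdegSq_sub_isBigO :
    (fun x : ℝ => (∑ n ∈ Finset.Icc 1 ⌊x⌋₊, cdegSq n) - (∑' n, cdegSqMoebius n / n) * x)
      =O[atTop] (fun x : ℝ => Real.log x ^ 3) := by
  refine (sum_mul_zeta_sub_isBigO abs_cdegSqMoebius_mul_le).congr_left fun x => ?_
  rw [cdegSqMoebius_mul_zeta]
  congr 1
  exact Finset.sum_congr rfl fun n hn => cdegSqFun_apply (Nat.pos_iff_ne_zero.1 (Finset.mem_Icc.1 hn).1)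

/-! ### Numerical bounds for the mean value -/

/-- The local factor at `p` of the mean value of the cyclicity degree of `(ℤ/nℤ)²`. -/
noncomputable def meanFactor (p : ℕ) : ℝ :=
  (1 - 1 / (p : ℝ)) * ∑' a : ℕ, cdegSq (p ^ a) / (p : ℝ) ^ a

theorem hasSum_const_div_pow_add {p : ℕ} (hp : 1 < p) (c : ℝ) (K : ℕ) :
    HasSum (fun a : ℕ => c / (p : ℝ) ^ (a + K)) (c / p ^ K * (1 - 1 / (p : ℝ))⁻¹) := by
  have h1 : (1 : ℝ) < p := by exact_mod_cast hp
  have hg := hasSum_geometric_of_lt_one (r := 1 / (p : ℝ)) (by positivity)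
    ((div_lt_one (by positivity)).2 h1)
  refine (hg.mul_left (c / p ^ K)).congr_fun fun a => ?_
  rw [pow_add, one_div_pow]
  field_simp

/-- By monotonicity `r a ≥ r K` in the tail, which becomes geometric; the prefactor `1 - 1/p`
cancels its sum. The lower bound `le_meanFactor` uses `r a ≤ 1/p` instead. -/
theorem meanFactor_le {p : ℕ} (hp : p.Prime) (K : ℕ) :
    meanFactor p ≤ 1 - (1 - 1 / (p : ℝ)) * ∑ a ∈ Finset.range K, primePowRatio p a / (p : ℝ) ^ a -
      primePowRatio p K / (p : ℝ) ^ K := by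
  have h1 : (1 : ℝ) < p := by exact_mod_cast hp.one_lt
  have h0 : 0 < 1 - 1 / (p : ℝ) := sub_pos.2 ((div_lt_one (by positivity)).2 h1)
  have hs := summable_primePowRatio_div_pow hp
  rw [meanFactor, one_sub_mul_tsum_cdegSq hp, ← hs.sum_add_tsum_nat_add K, mul_add]
  have htail := hasSum_le (fun a => ?_) (hasSum_const_div_pow_add hp.one_lt (primePowRatio p K) K)
    ((summable_nat_add_iff K).2 hs).hasSum
  · have := mul_le_mul_of_nonneg_left htail h0.le
    rw [mul_left_comm, mul_inv_cancel₀ h0.ne', mul_one] at this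
    linarith
  · gcongr
    exact primePowRatio_monotone hp.two_le (Nat.le_add_left _ _)

theorem le_meanFactor {p : ℕ} (hp : p.Prime) (K : ℕ) :
    1 - (1 - 1 / (p : ℝ)) * ∑ a ∈ Finset.range K, primePowRatio p a / (p : ℝ) ^ a -
      1 / (p : ℝ) / (p : ℝ) ^ K ≤ meanFactor p := by
  have h1 : (1 : ℝ) < p := by exact_mod_cast hp.one_lt
  have h0 : 0 < 1 - 1 / (p : ℝ) := sub_pos.2 ((div_lt_one (by positivity)).2 h1)
  have hs := summable_primePowRatio_div_pow hp
  rw [meanFactor, one_sub_mul_tsum_cdegSq hp, ← hs.sum_add_tsum_nat_add K, mul_add]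
  have htail := hasSum_le (fun a => ?_) ((summable_nat_add_iff K).2 hs).hasSum
    (hasSum_const_div_pow_add hp.one_lt (1 / (p : ℝ)) K)
  · have := mul_le_mul_of_nonneg_left htail h0.le
    rw [mul_left_comm, mul_inv_cancel₀ h0.ne', mul_one] at this
    linarith
  · gcongr
    exact primePowRatio_le hp.pos _

theorem meanFactor_le_one_sub {p : ℕ} (hp : p.Prime) :
    meanFactor p ≤ 1 - 1 / (p * (p + 3) : ℝ) := by
  have hp0 : (0 : ℝ) < p := by exact_mod_cast hp.pos
  refine (meanFactor_le hp 1).trans_eq ?_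
  simp [primePowRatio, primePowSubgroupCount]
  field_simp

theorem one_sub_sq_le_meanFactor {p : ℕ} (hp : p.Prime) :
    1 - ((p : ℝ) ^ 2)⁻¹ ≤ meanFactor p := by
  refine le_of_eq_of_le ?_ (le_meanFactor hp 1)
  simp [primePowRatio, sq, div_eq_mul_inv]

/-- The ratio of `meanFactor p` to the Euler factor `1 - p⁻²` of `1 / ζ(2)`, extended by `1` to
non-primes. -/
noncomputable def meanFactorRatio (n : ℕ) : ℝ :=
  if n.Prime then meanFactor n * (1 - ((n : ℝ) ^ 2)⁻¹)⁻¹ else 1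

theorem one_sub_inv_sq_pos {n : ℕ} (hn : 2 ≤ n) : 0 < 1 - ((n : ℝ) ^ 2)⁻¹ := by
  have : (2 : ℝ) ≤ n := by exact_mod_cast hn
  exact sub_pos.2 (inv_lt_one_of_one_lt₀ (by nlinarith))

theorem meanFactorRatio_of_prime {p : ℕ} (hp : p.Prime) :
    meanFactorRatio p = meanFactor p * (1 - ((p : ℝ) ^ 2)⁻¹)⁻¹ := if_pos hp

theorem one_le_meanFactorRatio (n : ℕ) : 1 ≤ meanFactorRatio n := by
  rw [meanFactorRatio]
  split_ifs with hn
  · rw [← div_eq_mul_inv, one_le_div (one_sub_inv_sq_pos hn.two_le)]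
    exact one_sub_sq_le_meanFactor hn
  · exact le_rfl

theorem meanFactorRatio_le {n : ℕ} (hn : 2 ≤ n) :
    meanFactorRatio n ≤ 1 + 3 / ((n - 1) * n * (n + 1) : ℝ) := by
  have h2 : (2 : ℝ) ≤ n := by exact_mod_cast hn
  have h3 : (0 : ℝ) < (n - 1) * n * (n + 1) := by
    have : (0 : ℝ) < n - 1 := by linarith
    positivity
  rw [meanFactorRatio]
  split_ifs with hp
  · rw [← div_eq_mul_inv, div_le_iff₀ (one_sub_inv_sq_pos hn)]
    refine (meanFactor_le_one_sub hp).trans ?_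
    have h4 : (0 : ℝ) < n - 1 := by linarith
    -- The sharper excess would be `3 / ((n + 3)(n² - 1))`; replacing `n + 3` by `n` makes the tail
    -- telescope.
    have e : (1 + 3 / ((n - 1) * n * (n + 1) : ℝ)) * (1 - ((n : ℝ) ^ 2)⁻¹) -
        (1 - 1 / (n * (n + 3) : ℝ)) = 9 / (n ^ 3 * (n + 3)) := by
      field_simp
      ring
    have : (0 : ℝ) ≤ 9 / (n ^ 3 * (n + 3)) := by positivity
    linarith
  · have := div_pos three_pos h3
    linarith

theorem hasProd_inv_one_sub_sq :
    HasProd (fun p : Nat.Primes => (1 - ((p : ℝ) ^ 2)⁻¹)⁻¹) (Real.pi ^ 2 / 6) := by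
  let f : ℕ →*₀ ℝ :=
    { toFun := fun n => ((n : ℝ) ^ 2)⁻¹
      map_zero' := by simp
      map_one' := by simp
      map_mul' := fun m n => by simp [mul_pow, mul_comm] }
  have hs : HasSum f (Real.pi ^ 2 / 6) := by
    simpa [f] using hasSum_zeta_two
  have h := EulerProduct.eulerProduct_completely_multiplicative_hasProd (f := f) hs.summable.norm
  rwa [hs.tsum_eq] at h

theorem tendsto_prod_meanFactorRatio {M : ℝ} (hM : HasProd (fun p : Nat.Primes => meanFactor p) M) :
    Tendsto (fun N => ∏ n ∈ Finset.range N, meanFactorRatio n) atTop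
      (nhds (M * (Real.pi ^ 2 / 6))) := by
  refine HasProd.tendsto_prod_nat ?_
  have h := hasProd_subtype_iff_mulIndicator (f := meanFactorRatio) (s := {p | p.Prime})
    (a := M * (Real.pi ^ 2 / 6))
  have e : Set.mulIndicator {p | p.Prime} meanFactorRatio = meanFactorRatio := by
    ext n
    by_cases hn : n.Prime <;> simp [meanFactorRatio, hn]
  rw [e] at h
  refine h.1 ((hM.mul hasProd_inv_one_sub_sq).congr_fun fun p => ?_)
  exact meanFactorRatio_of_prime p.2

/-- Telescoping of `3/((n-1)n(n+1)) = (3/2) (1/((n-1)n) - 1/(n(n+1)))` from `n = 101`, where `100 *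
101 = 10100`. -/
theorem prod_meanFactorRatio_le_mul {N : ℕ} (hN : 101 ≤ N) :
    ∏ n ∈ Finset.range N, meanFactorRatio n ≤
      (∏ n ∈ Finset.range 101, meanFactorRatio n) *
        Real.exp (3 / 2 * (1 / 10100 - 1 / ((N - 1) * N : ℝ))) := by
  induction N, hN using Nat.le_induction with
  | base => norm_num
  | succ N hN ih =>
    have hN' : (101 : ℝ) ≤ N := by exact_mod_cast hN
    rw [Finset.prod_range_succ]
    have h1 : meanFactorRatio N ≤ Real.exp (3 / ((N - 1) * N * (N + 1) : ℝ)) :=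
      (meanFactorRatio_le (by omega)).trans (by rw [add_comm]; exact Real.add_one_le_exp _)
    refine (mul_le_mul ih h1 (zero_le_one.trans (one_le_meanFactorRatio N)) ?_).trans_eq ?_
    · exact mul_nonneg (Finset.prod_nonneg fun n _ => zero_le_one.trans (one_le_meanFactorRatio n))
        (Real.exp_pos _).le
    · rw [mul_assoc, ← Real.exp_add]
      congr 2
      have h4 : (N : ℝ) - 1 ≠ 0 := by linarith
      have h5 : (N : ℝ) ≠ 0 := by linarith
      push_cast
      rw [add_sub_cancel_right]
      field_simp
      ring

theorem mul_pi_sq_div_six_le {M : ℝ} (hM : HasProd (fun p : Nat.Primes => meanFactor p) M) :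
    M * (Real.pi ^ 2 / 6) ≤ (∏ n ∈ Finset.range 101, meanFactorRatio n) * (1 / (1 - 3 / 20200)) := by
  refine le_of_tendsto (tendsto_prod_meanFactorRatio hM) ?_
  filter_upwards [eventually_ge_atTop 101] with N hN
  have hN' : (101 : ℝ) ≤ N := by exact_mod_cast hN
  refine (prod_meanFactorRatio_le_mul hN).trans (mul_le_mul_of_nonneg_left ?_
    (Finset.prod_nonneg fun n _ => zero_le_one.trans (one_le_meanFactorRatio n)))
  have h0 : 0 ≤ 1 / ((N - 1) * N : ℝ) := by
    have : (0 : ℝ) < N - 1 := by linarith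
    positivity
  have h1 : 3 / 2 * (1 / 10100 - 1 / ((N - 1) * N : ℝ)) ≤ 3 / 20200 := by linarith
  exact (Real.exp_le_exp.2 h1).trans
    (Real.exp_bound_div_one_sub_of_interval (by norm_num) (by norm_num))

theorem prod_le_mul_pi_sq_div_six {M : ℝ} (hM : HasProd (fun p : Nat.Primes => meanFactor p) M)
    (N₀ : ℕ) : ∏ n ∈ Finset.range N₀, meanFactorRatio n ≤ M * (Real.pi ^ 2 / 6) := by
  refine ge_of_tendsto (tendsto_prod_meanFactorRatio hM) ?_
  filter_upwards [eventually_ge_atTop N₀] with N hN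
  exact Finset.prod_le_prod_of_subset_of_one_le (Finset.range_mono hN)
    (fun n _ => zero_le_one.trans (one_le_meanFactorRatio n))
    fun n _ _ => one_le_meanFactorRatio n

/-- Rational upper bounds for `meanFactorRatio` at primes. -/
def ratioUpper (n : ℕ) : ℚ :=
  if n = 2 then 1.1388265
  else if n = 3 then 1.0486941
  else if n = 5 then 1.0132832
  else if n = 7 then 1.0055322
  else if n = 11 then 1.0016454
  else if n = 13 then 1.0010403
  else if n = 17 then 1.0004930
  else if n = 19 then 1.0003605
  else 1 + 3 / ((n + 3) * (n ^ 2 - 1))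

/-- Rational lower bounds for `meanFactorRatio` at primes. -/
def ratioLower (n : ℕ) : ℚ :=
  if n = 2 then 1.1387515
  else if n = 3 then 1.0486753
  else if n = 5 then 1.0132809
  else if n = 7 then 1.0055272
  else if n = 11 then 1.0016233
  else if n = 13 then 1.0010302
  else if n = 17 then 1.0004901
  else if n = 19 then 1.0003588
  else 1

theorem meanFactorRatio_le_of_le {p : ℕ} (hp : p.Prime) (K : ℕ) {u : ℝ}
    (h : 1 - (1 - 1 / (p : ℝ)) * ∑ a ∈ Finset.range K, primePowRatio p a / (p : ℝ) ^ a -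
      primePowRatio p K / (p : ℝ) ^ K ≤ u * (1 - ((p : ℝ) ^ 2)⁻¹)) : meanFactorRatio p ≤ u := by
  rw [meanFactorRatio_of_prime hp, ← div_eq_mul_inv, div_le_iff₀ (one_sub_inv_sq_pos hp.two_le)]
  exact (meanFactor_le hp K).trans h

theorem le_meanFactorRatio_of_le {p : ℕ} (hp : p.Prime) (K : ℕ) {l : ℝ}
    (h : l * (1 - ((p : ℝ) ^ 2)⁻¹) ≤
      1 - (1 - 1 / (p : ℝ)) * ∑ a ∈ Finset.range K, primePowRatio p a / (p : ℝ) ^ a -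
        1 / (p : ℝ) / (p : ℝ) ^ K) : l ≤ meanFactorRatio p := by
  rw [meanFactorRatio_of_prime hp, ← div_eq_mul_inv, le_div_iff₀ (one_sub_inv_sq_pos hp.two_le)]
  exact h.trans (le_meanFactor hp K)

theorem meanFactorRatio_le_ratioUpper {p : ℕ} (hp : p.Prime) : meanFactorRatio p ≤ ratioUpper p := by
  rw [ratioUpper]
  split_ifs with h2 h3 h5 h7 h11 h13 h17 h19
  · refine meanFactorRatio_le_of_le hp 9 ?_
    rw [h2]
    norm_num [Finset.sum_range_succ, primePowRatio, primePowSubgroupCount]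
  · refine meanFactorRatio_le_of_le hp 6 ?_
    rw [h3]
    norm_num [Finset.sum_range_succ, primePowRatio, primePowSubgroupCount]
  · refine meanFactorRatio_le_of_le hp 5 ?_
    rw [h5]
    norm_num [Finset.sum_range_succ, primePowRatio, primePowSubgroupCount]
  · refine meanFactorRatio_le_of_le hp 4 ?_
    rw [h7]
    norm_num [Finset.sum_range_succ, primePowRatio, primePowSubgroupCount]
  · refine meanFactorRatio_le_of_le hp 3 ?_
    rw [h11]
    norm_num [Finset.sum_range_succ, primePowRatio, primePowSubgroupCount]
  · refine meanFactorRatio_le_of_le hp 3 ?_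
    rw [h13]
    norm_num [Finset.sum_range_succ, primePowRatio, primePowSubgroupCount]
  · refine meanFactorRatio_le_of_le hp 3 ?_
    rw [h17]
    norm_num [Finset.sum_range_succ, primePowRatio, primePowSubgroupCount]
  · refine meanFactorRatio_le_of_le hp 3 ?_
    rw [h19]
    norm_num [Finset.sum_range_succ, primePowRatio, primePowSubgroupCount]
  · have h2 : (2 : ℝ) ≤ p := by exact_mod_cast hp.two_le
    have h3 : (0 : ℝ) < p ^ 2 - 1 := by nlinarith
    -- The default value in `ratioUpper` is exactly the truncation at `K = 1`.
    refine meanFactorRatio_le_of_le hp 1 (le_of_eq ?_)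
    push_cast
    simp [primePowRatio, primePowSubgroupCount]
    field_simp
    ring

theorem ratioLower_le_meanFactorRatio {p : ℕ} (hp : p.Prime) : (ratioLower p : ℝ) ≤ meanFactorRatio p := by
  rw [ratioLower]
  split_ifs with h2 h3 h5 h7 h11 h13 h17 h19
  · refine le_meanFactorRatio_of_le hp 7 ?_
    rw [h2]
    norm_num [Finset.sum_range_succ, primePowRatio, primePowSubgroupCount]
  · refine le_meanFactorRatio_of_le hp 5 ?_
    rw [h3]
    norm_num [Finset.sum_range_succ, primePowRatio, primePowSubgroupCount]
  · refine le_meanFactorRatio_of_le hp 4 ?_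
    rw [h5]
    norm_num [Finset.sum_range_succ, primePowRatio, primePowSubgroupCount]
  · refine le_meanFactorRatio_of_le hp 3 ?_
    rw [h7]
    norm_num [Finset.sum_range_succ, primePowRatio, primePowSubgroupCount]
  · refine le_meanFactorRatio_of_le hp 2 ?_
    rw [h11]
    norm_num [Finset.sum_range_succ, primePowRatio, primePowSubgroupCount]
  · refine le_meanFactorRatio_of_le hp 2 ?_
    rw [h13]
    norm_num [Finset.sum_range_succ, primePowRatio, primePowSubgroupCount]
  · refine le_meanFactorRatio_of_le hp 2 ?_
    rw [h17]
    norm_num [Finset.sum_range_succ, primePowRatio, primePowSubgroupCount]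
  · refine le_meanFactorRatio_of_le hp 2 ?_
    rw [h19]
    norm_num [Finset.sum_range_succ, primePowRatio, primePowSubgroupCount]
  · simpa using one_le_meanFactorRatio p

theorem prod_range_meanFactorRatio (N : ℕ) :
    ∏ n ∈ Finset.range N, meanFactorRatio n =
      ∏ p ∈ (Finset.range N).filter Nat.Prime, meanFactorRatio p :=
  (Finset.prod_filter_of_ne fun n _ h => by
    by_contra hn
    exact h (if_neg hn)).symm

theorem filter_prime_range_20 :
    (Finset.range 20).filter Nat.Prime = {2, 3, 5, 7, 11, 13, 17, 19} := by
  decide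

theorem filter_prime_range_101 :
    (Finset.range 101).filter Nat.Prime =
      {2, 3, 5, 7, 11, 13, 17, 19, 23, 29, 31, 37, 41, 43, 47, 53, 59, 61, 67, 71, 73, 79, 83, 89,
        97} := by
  decide +kernel

/-- The constant is tight: with the tail factor and `π² > 9.8696` it gives `M < 0.742993`. -/
theorem prod_meanFactorRatio_le : ∏ n ∈ Finset.range 101, meanFactorRatio n ≤ 1.22199 := by
  rw [prod_range_meanFactorRatio]
  refine (Finset.prod_le_prod (fun n _ => zero_le_one.trans (one_le_meanFactorRatio n))
    fun p hp => meanFactorRatio_le_ratioUpper (Finset.mem_filter.1 hp).2).trans ?_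
  rw [filter_prime_range_101]
  norm_num [ratioUpper]

/-- Later ratios are at least 1 and can be dropped; `6 * 1.2207 / 9.8697` already exceeds 0.742. -/
theorem le_prod_meanFactorRatio : 1.2207 ≤ ∏ n ∈ Finset.range 20, meanFactorRatio n := by
  rw [prod_range_meanFactorRatio]
  refine le_trans ?_ (Finset.prod_le_prod (fun n _ => ?_)
    fun p hp => ratioLower_le_meanFactorRatio (Finset.mem_filter.1 hp).2)
  · rw [filter_prime_range_20]
    norm_num [ratioLower]
  · rw [ratioLower]
    split_ifs <;> norm_num

theorem mean_bounds {M : ℝ} (hM : HasProd (fun p : Nat.Primes => meanFactor p) M) :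
    0.742 < M ∧ M < 0.743 := by
  have h1 := mul_pi_sq_div_six_le hM
  have h2 := prod_le_mul_pi_sq_div_six hM 20
  have h3 := prod_meanFactorRatio_le
  have h4 := le_prod_meanFactorRatio
  have hl : 9.8696 < Real.pi ^ 2 := by nlinarith [Real.pi_gt_d6]
  have hu : Real.pi ^ 2 < 9.8697 := by nlinarith [Real.pi_lt_d6, Real.pi_pos]
  constructor
  · by_contra h
    rw [not_lt] at h
    nlinarith
  · by_contra h
    rw [not_lt] at h
    nlinarith

theorem theorem3p1p3 :
    (cdegSq 1 = 1 ∧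
      ∀ m n : ℕ, 0 < m → 0 < n → m.Coprime n → cdegSq (m * n) = cdegSq m * cdegSq n) ∧
    (∀ p : ℕ, p.Prime → Summable (fun a : ℕ => cdegSq (p ^ a) / (p : ℝ) ^ a)) ∧
    ∃ M : ℝ,
      HasProd (fun p : Nat.Primes =>
        (1 - 1 / (p : ℝ)) * ∑' a : ℕ, cdegSq ((p : ℕ) ^ a) / (p : ℝ) ^ a) M ∧
      0.742 < M ∧ M < 0.743 ∧
      (fun x : ℝ => (∑ n ∈ Finset.Icc 1 ⌊x⌋₊, cdegSq n) - M * x)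
        =O[atTop] (fun x : ℝ => Real.log x ^ 3) := by
  refine ⟨⟨cdegSq_one, fun m n _ _ h => cdegSq_mul h⟩,
    fun p hp => (hasSum_cdegSq_prime_pow_div hp).summable, ∑' n, cdegSqMoebius n / n,
    hasProd_one_sub_mul_tsum_cdegSq, ?_⟩
  have h := mean_bounds hasProd_one_sub_mul_tsum_cdegSq
  exact ⟨h.1, h.2, sum_cdegSq_sub_isBigO⟩
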